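/- Let $X$ be a compact metric space and $T\colon X\to X$ a continuous map. For $Z\subseteq X$ let $h_{\rm top}(Z)\in[0,\infty]$ be Bowen's topological entropy: with $B_n(x,\varepsilon)=\{y: d(T^jx,T^jy)<\varepsilon,\ 0\le j<n\}$, put $$H^s(Z,\varepsilon)=\lim_{N\to\infty}\ \inf\Bigl\{\sum_i e^{-sn_i}\Bigr\}\qquad(s\ge 0),$$ where the infimum is over all at most countable covers $\{B_{n_i}(x_i,\varepsilon)\}_i$ of $Z$ with all $n_i\ge \max(N,1)$; let $h_{\rm top}(Z,\varepsilon)=\inf\{s\ge0: H^s(Z,\varepsilon)=0\}$ be the critical value, and $h_{\rm top}(Z)=\lim_{\varepsilon\to0}h_{\rm top}(Z,\varepsilon)$. Let $\mathcal M_{\rm inv}$ be the set of $T$-invariant Borel probability measures on $X$, and let $h_\mu\in[0,\infty]$ be the measure-theoretic (Kolmogorov–Sinai) entropy of $\mu\in\mathcal M_{\rm inv}$. Let $G_\mu$ be the set of $x\in X$ such that $\frac1n\sum_{j=0}^{n-1}\delta_{T^jx}\to\mu$ in the weak-* topology. The system $(X,T)$ is called saturated if $h_{\rm top}(G_\mu)=h_\mu$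 for every $\mu\in\mathcal M_{\rm inv}$. For a real Banach space $\mathbb B$, a map $\Phi\colon X\to\mathbb B^*$ that is continuous for the weak-* topology $\sigma(\mathbb B^*,\mathbb B)$, $\alpha\in\mathbb B^*$ and $E\subseteq\mathbb B$, let $A_n\Phi(x)=\frac1n\sum_{j=0}^{n-1}\Phi(T^jx)$ and $$X_\Phi(\alpha;E)=\Bigl\{x\in X:\ \limsup_{n\to\infty}\langle A_n\Phi(x),w\rangle\le\langle\alpha,w\rangle\ \text{ for all } w\in E\Bigr\},$$ $$\mathcal M_\Phi(\alpha;E)=\Bigl\{\mu\in\mathcal M_{\rm inv}:\ \int\langle\Phi,w\rangle\,d\mu\le\langle\alpha,w\rangle\ \text{ for all } w\in E\Bigr\}.$$ **Theorem.** The system $(X,T)$ is saturated if and only if the following variational principle holds: for every real Banach space $\mathbb B$, every weak-* continuous $\Phi\colon X\to\mathbb B^*$, every $\alpha\in\mathbb B^*$ and every $E\subseteq\mathbb B$ with $\mathcal M_\Phi(\alpha;E)\neq\emptyset$, $$h_{\rm top}\bigl(X_\Phi(\alpha;E)\bigr)=\sup_{\mu\in\mathcal M_\Phi(\alpha;E)}h_\mu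 .$$ -/

import Mathlib

open MeasureTheory Filter Topology
open scoped ENNReal NNReal

namespace SaturatedSystem

/-! ### Bowen's topological entropy of a subset -/

section TopologicalEntropy

variable {X : Type*} [MetricSpace X]

/-- The open ball `B_n(x, ε)` of the Bowen metric `d_n(x, y) = max_{0 ≤ j < n} d(T^j x, T^j y)`. -/
def bowenBall (T : X → X) (n : ℕ) (x : X) (ε : ℝ) : Set X :=
  {y | ∀ j < n, dist (T^[j] y) (T^[j] x) < ε}

/-- `R`, a set of pairs `(nᵢ, xᵢ)`, is an at most countable family of Bowen balls
`B_{nᵢ}(xᵢ, ε)`, `nᵢ ≥ 1`, which covers `Z` and satisfies `nᵢ ≥ N` for all `i`. -/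
structure IsBowenCover (T : X → X) (Z : Set X) (ε : ℝ) (N : ℕ) (R : Set (ℕ × X)) : Prop where
  countable : R.Countable
  pos : ∀ p ∈ R, 1 ≤ p.1
  le : ∀ p ∈ R, N ≤ p.1
  cover : Z ⊆ ⋃ p ∈ R, bowenBall T p.1 p.2 ε

/-- The sum `∑ᵢ exp(-s nᵢ)` over a family of pairs `(nᵢ, xᵢ)`. -/
noncomputable def coverWeight (s : ℝ≥0) (R : Set (ℕ × X)) : ℝ≥0∞ :=
  ∑' p : R, ENNReal.ofReal (Real.exp (-((s : ℝ) * (p.1.1 : ℝ))))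

/-- `H^s_N(Z, ε)`. -/
noncomputable def bowenPremeasure (T : X → X) (s : ℝ≥0) (Z : Set X) (ε : ℝ) (N : ℕ) : ℝ≥0∞ :=
  ⨅ (R : Set (ℕ × X)) (_ : IsBowenCover T Z ε N R), coverWeight s R

/-- `H^s(Z, ε) = lim_{N → ∞} H^s_N(Z, ε)`, a monotone limit
(see `tendsto_bowenPremeasure`). -/
noncomputable def bowenMeasure (T : X → X) (s : ℝ≥0) (Z : Set X) (ε : ℝ) : ℝ≥0∞ :=
  ⨆ N : ℕ, bowenPremeasure T s Z ε N

/-- `h_top(Z, ε)`, the critical value of `s ↦ H^s(Z, ε)`, `s ≥ 0`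
(see `bowenMeasure_eq_zero` and `bowenMeasure_eq_top`). -/
noncomputable def topEntropyAt (T : X → X) (Z : Set X) (ε : ℝ) : ℝ≥0∞ :=
  ⨅ (s : ℝ≥0) (_ : bowenMeasure T s Z ε = 0), (s : ℝ≥0∞)

/-- `h_top(Z) = lim_{ε → 0+} h_top(Z, ε)`, a monotone limit (see `tendsto_topEntropyAt`). -/
noncomputable def topEntropy (T : X → X) (Z : Set X) : ℝ≥0∞ :=
  ⨆ (ε : ℝ) (_ : 0 < ε), topEntropyAt T Z ε

theorem bowenPremeasure_mono (T : X → X) (s : ℝ≥0) (Z : Set X) (ε : ℝ) :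
    Monotone (bowenPremeasure T s Z ε) := fun _ _ h =>
  le_iInf₂ fun R hR =>
    iInf₂_le R ⟨hR.countable, hR.pos, fun p hp => h.trans (hR.le p hp), hR.cover⟩

theorem tendsto_bowenPremeasure (T : X → X) (s : ℝ≥0) (Z : Set X) (ε : ℝ) :
    Tendsto (bowenPremeasure T s Z ε) atTop (𝓝 (bowenMeasure T s Z ε)) :=
  tendsto_atTop_iSup (bowenPremeasure_mono T s Z ε)

theorem bowenPremeasure_le_exp_mul (T : X → X) {s t : ℝ≥0} (h : s ≤ t) (Z : Set X) (ε : ℝ)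
    (N : ℕ) : bowenPremeasure T t Z ε N ≤
      ENNReal.ofReal (Real.exp (-(((t : ℝ) - s) * N))) * bowenPremeasure T s Z ε N := by
  have h0 : ENNReal.ofReal (Real.exp (-(((t : ℝ) - s) * N))) ≠ 0 := by
    simpa using Real.exp_pos _
  unfold bowenPremeasure
  rw [ENNReal.mul_iInf_of_ne h0 ENNReal.ofReal_ne_top]
  refine le_iInf fun R => ?_
  rw [ENNReal.mul_iInf_of_ne h0 ENNReal.ofReal_ne_top]
  refine le_iInf fun hR => (iInf₂_le R hR).trans ?_
  unfold coverWeight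
  rw [← ENNReal.tsum_mul_left]
  refine ENNReal.tsum_le_tsum fun p => ?_
  rw [← ENNReal.ofReal_mul (Real.exp_pos _).le, ← Real.exp_add]
  refine ENNReal.ofReal_le_ofReal (Real.exp_le_exp.2 ?_)
  have h1 : (N : ℝ) ≤ (p.1.1 : ℝ) := by exact_mod_cast hR.le p.1 p.2
  have h2 : (0 : ℝ) ≤ (t : ℝ) - s := sub_nonneg.2 (by exact_mod_cast h)
  nlinarith [mul_le_mul_of_nonneg_left h1 h2]

theorem bowenMeasure_eq_zero_of_lt (T : X → X) {s t : ℝ≥0} (h : s < t) (Z : Set X) (ε : ℝ)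
    (hs : bowenMeasure T s Z ε ≠ ⊤) : bowenMeasure T t Z ε = 0 := by
  have h2 : (0 : ℝ) < (t : ℝ) - s := sub_pos.2 (by exact_mod_cast h)
  have key : Tendsto (fun N : ℕ => ENNReal.ofReal (Real.exp (-(((t : ℝ) - s) * N))) *
      bowenMeasure T s Z ε) atTop (𝓝 0) := by
    have h3 : Tendsto (fun N : ℕ => Real.exp (-(((t : ℝ) - s) * N))) atTop (𝓝 0) :=
      Real.tendsto_exp_neg_atTop_nhds_zero.comp
        (tendsto_natCast_atTop_atTop.const_mul_atTop h2)
    have h4 := ENNReal.Tendsto.mul_const (ENNReal.tendsto_ofReal h3)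
      (Or.inr hs : _ ∨ bowenMeasure T s Z ε ≠ ⊤)
    simpa using h4
  refine le_antisymm (le_of_tendsto_of_tendsto' (tendsto_bowenPremeasure T t Z ε) key
    fun N => ?_) zero_le
  exact (bowenPremeasure_le_exp_mul T h.le Z ε N).trans
    (mul_le_mul_right (le_iSup (bowenPremeasure T s Z ε) N) _)

theorem bowenMeasure_eq_zero (T : X → X) (Z : Set X) (ε : ℝ) (s : ℝ≥0)
    (h : topEntropyAt T Z ε < s) : bowenMeasure T s Z ε = 0 := by
  simp only [topEntropyAt, iInf_lt_iff] at h
  obtain ⟨r, hr, hrs⟩ := h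
  exact bowenMeasure_eq_zero_of_lt T (by exact_mod_cast hrs) Z ε (by simp [hr])

theorem bowenMeasure_eq_top (T : X → X) (Z : Set X) (ε : ℝ) (s : ℝ≥0)
    (h : (s : ℝ≥0∞) < topEntropyAt T Z ε) : bowenMeasure T s Z ε = ⊤ := by
  by_contra hs
  obtain ⟨r, hsr, hr⟩ := ENNReal.lt_iff_exists_nnreal_btwn.1 h
  exact absurd (iInf₂_le r (bowenMeasure_eq_zero_of_lt T (by exact_mod_cast hsr) Z ε hs))
    (not_le.2 hr)

theorem topEntropyAt_anti (T : X → X) (Z : Set X) : Antitone (topEntropyAt T Z) := by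
  intro ε δ h
  refine le_iInf₂ fun s hs => ?_
  suffices hle : bowenMeasure T s Z δ ≤ bowenMeasure T s Z ε from
    iInf_le_of_le s (iInf_le _ (le_antisymm (hle.trans hs.le) zero_le))
  refine iSup_mono fun N => le_iInf₂ fun R hR => iInf₂_le R
    ⟨hR.countable, hR.pos, hR.le, hR.cover.trans ?_⟩
  exact Set.iUnion₂_mono fun p _ y hy j hj => (hy j hj).trans_le h

theorem tendsto_topEntropyAt (T : X → X) (Z : Set X) :
    Tendsto (topEntropyAt T Z) (𝓝[>] 0) (𝓝 (topEntropy T Z)) := by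
  have h := (topEntropyAt_anti T Z).tendsto_nhdsGT 0
  rwa [sSup_image] at h

end TopologicalEntropy

/-! ### Measure-theoretic entropy, invariant measures, generic points -/

section Measures

variable {X : Type*} [MeasurableSpace X]

/-- Shannon entropy of the join `⋁_{i < n} T^{-i} P` of a finite measurable partition, which is
given as the level sets of a map `P : X → Fin k`: the atoms of the join are the level sets of
`x ↦ (P (T^i x))_{i < n}`, and `Real.negMulLog t = -t log t`. -/
noncomputable def joinEntropy (T : X → X) (μ : Measure X) {k : ℕ} (P : X → Fin k) (n : ℕ) : ℝ :=
  ∑ a : Fin n → Fin k, Real.negMulLog (μ.real {x | ∀ i : Fin n, P (T^[i] x) = a i})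

/-- Entropy of `T` relative to the partition `P`: the limit of `n⁻¹ H(⋁_{i < n} T^{-i} P)`,
which exists, by subadditivity, when `μ` is invariant. -/
noncomputable def partitionEntropy (T : X → X) (μ : Measure X) {k : ℕ} (P : X → Fin k) : ℝ≥0∞ :=
  limsup (fun n : ℕ => ENNReal.ofReal (joinEntropy T μ P n / n)) atTop

/-- The Kolmogorov–Sinai entropy `h_μ`: the supremum over all finite measurable partitions. -/
noncomputable def measureEntropy (T : X → X) (μ : Measure X) : ℝ≥0∞ :=
  ⨆ (k : ℕ) (P : X → Fin k) (_ : Measurable P), partitionEntropy T μ P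

/-- The set of `T`-invariant probability measures. -/
def invariantMeasures (T : X → X) : Set (ProbabilityMeasure X) :=
  {μ | MeasurePreserving T (μ : Measure X) (μ : Measure X)}

/-- The empirical measure `(n + 1)⁻¹ ∑_{j = 0}^{n} δ_{T^j x}`. -/
noncomputable def empiricalMeasure (T : X → X) (x : X) (n : ℕ) : ProbabilityMeasure X :=
  ⟨((n + 1 : ℕ) : ℝ≥0∞)⁻¹ • ∑ j ∈ Finset.range (n + 1), Measure.dirac (T^[j] x), ⟨by
    simp only [Measure.smul_apply, Measure.finsetSum_apply, measure_univ, Finset.sum_const,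
      Finset.card_range, smul_eq_mul, nsmul_eq_mul, mul_one]
    exact ENNReal.inv_mul_cancel (by simp) (ENNReal.natCast_ne_top _)⟩⟩

/-- The set `G_μ` of `μ`-generic points; the topology on `ProbabilityMeasure X` is that of weak
convergence (against bounded continuous functions). -/
def genericPoints [TopologicalSpace X] [OpensMeasurableSpace X] (T : X → X)
    (μ : ProbabilityMeasure X) : Set X :=
  {x | Tendsto (empiricalMeasure T x) atTop (𝓝 μ)}

/-- `h_top(G_μ) = h_μ` for every invariant probability measure `μ`. -/
def IsSaturated {X : Type*} [MetricSpace X] [MeasurableSpace X] [BorelSpace X]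
    (T : X → X) : Prop :=
  ∀ μ ∈ invariantMeasures T, topEntropy T (genericPoints T μ) = measureEntropy T (μ : Measure X)

end Measures

/-! ### Banach-valued Birkhoff averages

`WeakDual ℝ B` is the dual of `B` with the topology `σ(B*, B)`. -/

section Birkhoff

variable {X : Type*} {B : Type*} [NormedAddCommGroup B] [NormedSpace ℝ B]

/-- `X_Φ(α; E)`: the points with `limsup_n ⟨A_n Φ(x), w⟩ ≤ ⟨α, w⟩` for all `w ∈ E`, where
`A_n Φ(x) = n⁻¹ ∑_{j < n} Φ(T^j x)`. -/
def birkhoffSet (T : X → X) (Φ : X → WeakDual ℝ B) (α : WeakDual ℝ B) (E : Set B) : Set X :=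
  {x | ∀ w ∈ E, limsup (fun n : ℕ => birkhoffAverage ℝ T Φ n x w) atTop ≤ α w}

/-- `M_Φ(α; E)`: the invariant probability measures with `∫ ⟨Φ, w⟩ dμ ≤ ⟨α, w⟩` for all
`w ∈ E`. -/
def birkhoffMeasures [MeasurableSpace X] (T : X → X) (Φ : X → WeakDual ℝ B)
    (α : WeakDual ℝ B) (E : Set B) : Set (ProbabilityMeasure X) :=
  {μ | μ ∈ invariantMeasures T ∧ ∀ w ∈ E, ∫ x, Φ x w ∂(μ : Measure X) ≤ α w}

end Birkhoff

end SaturatedSystem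

/-! The upper bound in the variational principle holds in every system and is Bowen's argument. For
`x` in the Birkhoff set, every cluster point of the empirical measures is invariant and satisfies
the same inequalities (`mem_birkhoffMeasures_of_mapClusterPt`), and such cluster points exist by
compactness. It therefore suffices to bound the entropy of points accumulating on a compact set of
invariant measures of entropy at most `t` (`topEntropy_mapClusterPt_le`).

That bound is a coding argument. Near a measure `μ`, take a fine partition with `μ`-null boundaries
and a finite-memory kernel whose mean code length under `μ` is below `s`. The mean code length is
continuous at `μ`, so the empirical measures that come near `μ` give infinitely many prefixes of the
orbit name with weight at least `exp (-s n)`. The words of each length have bounded total weight, as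
in Kraft's inequality, so few Bowen balls are needed. Compactness then leaves finitely many
neighbourhoods.

Saturation gives the lower bound, since the Birkhoff set contains `G_μ` for each admissible `μ`.
Conversely, let `Φ` send `x` to the Dirac mass at `x` on `C(X)`, let `α` be integration against `μ`,
and impose all test functions. The only admissible measure is then `μ`, the Birkhoff set is `G_μ`,
and the principle becomes saturation at `μ`. -/

namespace SaturatedSystem

/-! ### Words and Markov weights -/

section Words

variable {X : Type*}

/-- The name of `x` of length `n` relative to the partition `P`. -/
def itinerary (T : X → X) {k : ℕ} (P : X → Fin k) (n : ℕ) (x : X) : Fin n → Fin k :=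
  fun i => P (T^[i] x)

theorem init_itinerary (T : X → X) {k : ℕ} (P : X → Fin k) (n : ℕ) (x : X) :
    Fin.init (α := fun _ => Fin k) (itinerary T P (n + 1) x) = itinerary T P n x := rfl

theorem setOf_eq_itinerary_preimage (T : X → X) {k : ℕ} (P : X → Fin k) (n : ℕ)
    (a : Fin n → Fin k) :
    {x | ∀ i : Fin n, P (T^[i] x) = a i} = itinerary T P n ⁻¹' {a} := by
  ext x
  simp [itinerary, funext_iff]

theorem measurable_itinerary [MeasurableSpace X] {T : X → X} (hT : Measurable T) {k : ℕ}
    {P : X → Fin k} (hP : Measurable P) (n : ℕ) : Measurable (itinerary T P n) :=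
  measurable_pi_lambda _ fun i => hP.comp (hT.iterate i)

theorem joinEntropy_eq [MeasurableSpace X] (T : X → X) (μ : Measure X) {k : ℕ}
    (P : X → Fin k) (n : ℕ) :
    joinEntropy T μ P n = ∑ a, Real.negMulLog (μ.real (itinerary T P n ⁻¹' {a})) := by
  simp only [joinEntropy, setOf_eq_itinerary_preimage]

theorem sum_words_snoc {k n : ℕ} {M : Type*} [AddCommMonoid M] (f : (Fin (n + 1) → Fin k) → M) :
    ∑ a, f a = ∑ b : Fin n → Fin k, ∑ c : Fin k, f (Fin.snoc (α := fun _ => Fin k) b c) := by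
  rw [← (Fin.snocEquiv (fun _ : Fin (n + 1) => Fin k)).sum_comp, Fintype.sum_prod_type,
    Finset.sum_comm]
  rfl

theorem measureReal_itinerary_eq_sum [MeasurableSpace X] {T : X → X} (hT : Measurable T)
    (μ : Measure X) [IsFiniteMeasure μ] {k : ℕ} {P : X → Fin k} (hP : Measurable P) (n : ℕ)
    (b : Fin n → Fin k) :
    μ.real (itinerary T P n ⁻¹' {b}) =
      ∑ c, μ.real (itinerary T P (n + 1) ⁻¹' {Fin.snoc (α := fun _ => Fin k) b c}) := by
  rw [← measureReal_iUnion_fintype]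
  · congr 1
    ext x
    simp only [Set.mem_preimage, Set.mem_singleton_iff, Set.mem_iUnion]
    constructor
    · intro h
      refine ⟨itinerary T P (n + 1) x (Fin.last n), ?_⟩
      rw [← h, ← init_itinerary]
      exact (Fin.snoc_init_self (α := fun _ => Fin k) (itinerary T P (n + 1) x)).symm
    · rintro ⟨c, hc⟩
      rw [← init_itinerary, hc, Fin.init_snoc]
  · intro c d hcd
    refine Set.disjoint_left.2 fun x hx hy => hcd ?_
    simp only [Set.mem_preimage, Set.mem_singleton_iff] at hx hy
    rw [hx] at hy
    simpa using congrFun hy (Fin.last n)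
  · exact fun c => measurable_itinerary hT hP _ (measurableSet_singleton _)

theorem joinEntropy_zero [MeasurableSpace X] (T : X → X) (μ : Measure X) [IsProbabilityMeasure μ]
    {k : ℕ} (P : X → Fin k) : joinEntropy T μ P 0 = 0 := by
  simp [joinEntropy]

/-- If every increment were at least `s`, telescoping from the zero entropy of the empty word would
give `H_n ≥ n s`, forcing the limsup up to `s`. This needs neither invariance nor monotone
conditional entropies. -/
theorem exists_joinEntropy_succ_sub_lt [MeasurableSpace X] (T : X → X) (μ : Measure X)
    [IsProbabilityMeasure μ] {k : ℕ} (P : X → Fin k) {s : ℝ}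
    (hs : partitionEntropy T μ P < ENNReal.ofReal s) :
    ∃ m, joinEntropy T μ P (m + 1) - joinEntropy T μ P m < s := by
  by_contra! h
  have h1 : ∀ n : ℕ, n * s ≤ joinEntropy T μ P n := by
    intro n
    induction n with
    | zero => simp [joinEntropy_zero]
    | succ n ih => push_cast; linarith [h n]
  refine absurd hs (not_lt.2 ?_)
  refine le_limsup_of_frequently_le (Eventually.frequently ?_)
  filter_upwards [eventually_gt_atTop 0] with n hn
  refine ENNReal.ofReal_le_ofReal ?_
  rw [le_div_iff₀ (by exact_mod_cast hn)]
  linarith [h1 n]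

/-- If the entropy of `P` is below `s`, some positive sub-Markov kernel with finite memory codes
the names of `P` at cost below `s`. -/
theorem exists_kernel_crossEntropy_lt [MeasurableSpace X] {T : X → X} (hT : Measurable T)
    (μ : Measure X) [IsProbabilityMeasure μ] {k : ℕ} {P : X → Fin k} (hP : Measurable P) {s : ℝ}
    (hs : partitionEntropy T μ P < ENNReal.ofReal s) :
    ∃ (m : ℕ) (q : (Fin m → Fin k) → Fin k → ℝ), (∀ b c, 0 < q b c) ∧ (∀ b, ∑ c, q b c ≤ 1) ∧
      ∑ b, μ.real (itinerary T P (m + 1) ⁻¹' {b}) *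
        -Real.log (q (Fin.init (α := fun _ => Fin k) b) (b (Fin.last m))) < s := by
  obtain ⟨m, hm⟩ := exists_joinEntropy_succ_sub_lt T μ P hs
  set p : (Fin m → Fin k) → Fin k → ℝ := fun b c =>
    μ.real (itinerary T P (m + 1) ⁻¹' {Fin.snoc (α := fun _ => Fin k) b c}) with hp
  set p' : (Fin m → Fin k) → ℝ := fun b => μ.real (itinerary T P m ⁻¹' {b}) with hp'
  have hsum : ∀ b, p' b = ∑ c, p b c := fun b => measureReal_itinerary_eq_sum hT μ hP m b
  have hp0 : ∀ b c, 0 ≤ p b c := fun b c => measureReal_nonneg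
  have hp'0 : ∀ b, 0 ≤ p' b := fun b => measureReal_nonneg
  have hle : ∀ b c, p b c ≤ p' b := fun b c => by
    rw [hsum]
    exact Finset.single_le_sum (f := p b) (fun c _ => hp0 b c) (Finset.mem_univ c)
  -- Chain rule: the increment is the conditional entropy of the last letter given the preceding
  -- `m`, which is the mean code length under the true conditional probabilities.
  have hent : ∑ b, ∑ c, p b c * -Real.log (p b c / p' b) < s := by
    refine lt_of_eq_of_lt ?_ hm
    rw [joinEntropy_eq, joinEntropy_eq, sum_words_snoc, ← Finset.sum_sub_distrib]
    refine Finset.sum_congr rfl fun b _ => ?_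
    have h1 : ∀ c, p b c * -Real.log (p b c / p' b) =
        Real.negMulLog (p b c) + p b c * Real.log (p' b) := by
      intro c
      rcases (hp0 b c).eq_or_lt with h0 | h0
      · simp [← h0]
      · rw [Real.log_div h0.ne' (h0.trans_le (hle b c)).ne', Real.negMulLog]
        ring
    rw [Finset.sum_congr rfl fun c _ => h1 c, Finset.sum_add_distrib, ← Finset.sum_mul, ← hsum,
      Real.negMulLog]
    simp only [hp, hp']
    ring
  -- Conditional probabilities may vanish, but the kernel must be positive. Adding `η` to each entry
  -- and `k * η` to the normaliser repairs this at a cost tending to zero; terms with `p b c = 0`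
  -- contribute nothing for any `η`.
  have hlim : Tendsto (fun η : ℝ => ∑ b, ∑ c, p b c * -Real.log ((p b c + η) / (p' b + k * η)))
      (𝓝[>] 0) (𝓝 (∑ b, ∑ c, p b c * -Real.log (p b c / p' b))) := by
    refine tendsto_finsetSum _ fun b _ => tendsto_finsetSum _ fun c _ => ?_
    rcases (hp0 b c).eq_or_lt with h0 | h0
    · simp [← h0]
    · have h1 : p' b ≠ 0 := (h0.trans_le (hle b c)).ne'
      have h2 : ContinuousAt (fun η : ℝ => p b c * -Real.log ((p b c + η) / (p' b + k * η))) 0 := by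
        refine continuousAt_const.mul (ContinuousAt.neg (ContinuousAt.log ?_ ?_))
        · exact ContinuousAt.div (by fun_prop) (by fun_prop) (by simpa using h1)
        · simpa using ⟨h0.ne', h1⟩
      simpa using h2.tendsto.mono_left nhdsWithin_le_nhds
  obtain ⟨η, hη, hη0⟩ := ((hlim.eventually (gt_mem_nhds hent)).and self_mem_nhdsWithin).exists
  have hη0 : 0 < η := hη0
  refine ⟨m, fun b c => (p b c + η) / (p' b + k * η), fun b c => ?_, fun b => ?_, ?_⟩
  · have hk : (0 : ℝ) < k := by exact_mod_cast c.pos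
    exact div_pos (add_pos_of_nonneg_of_pos (hp0 b c) hη0)
      (add_pos_of_nonneg_of_pos (hp'0 b) (mul_pos hk hη0))
  · rw [← Finset.sum_div, Finset.sum_add_distrib, ← hsum]
    -- The inequality also covers the empty alphabet, where the quotient is `0 / 0 = 0`.
    simpa using div_self_le_one _
  · rw [sum_words_snoc]
    simpa using hη

/-- The weight of a word of length `m + n` under the kernel `q` with memory `m`. -/
def wordWeight {k m : ℕ} (q : (Fin m → Fin k) → Fin k → ℝ) (n : ℕ) (a : Fin (m + n) → Fin k) : ℝ :=
  ∏ j : Fin n, q (fun i => a ⟨j + i, by omega⟩) (a ⟨m + j, by omega⟩)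

/-- Summing out the last letter costs a factor at most one. After `n` steps only the `k ^ m` initial
words of unit weight remain. -/
theorem sum_wordWeight_le {k m : ℕ} {q : (Fin m → Fin k) → Fin k → ℝ} (hq0 : ∀ b c, 0 < q b c)
    (hq1 : ∀ b, ∑ c, q b c ≤ 1) (n : ℕ) : ∑ a, wordWeight q n a ≤ (k : ℝ) ^ m := by
  induction n with
  | zero => simp [wordWeight]
  | succ n ih =>
    refine le_trans ?_ ih
    change ∑ a : Fin ((m + n) + 1) → Fin k, wordWeight q (n + 1) a ≤ _
    rw [sum_words_snoc]
    refine Finset.sum_le_sum fun b _ => ?_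
    have h : ∀ c, wordWeight q (n + 1) (Fin.snoc (α := fun _ => Fin k) b c) =
        wordWeight q n b * q (fun i => b ⟨n + i, by omega⟩) c := by
      intro c
      have hs : ∀ (j : ℕ) (h1 : j < m + n + 1) (h2 : j < m + n),
          Fin.snoc (α := fun _ => Fin k) b c ⟨j, h1⟩ = b ⟨j, h2⟩ := fun j h1 h2 =>
        Fin.snoc_castSucc (α := fun _ => Fin k) c b ⟨j, h2⟩
      have hl : Fin.snoc (α := fun _ => Fin k) b c ⟨m + n, by omega⟩ = c :=
        Fin.snoc_last (α := fun _ => Fin k) c b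
      unfold wordWeight
      rw [Fin.prod_univ_castSucc]
      congr 1
      · refine Finset.prod_congr rfl fun j _ => ?_
        congr 1
        · funext i
          exact hs _ _ _
        · exact hs _ _ _
      · congr 1
        funext i
        exact hs _ _ _
    rw [Finset.sum_congr rfl fun c _ => h c, ← Finset.mul_sum]
    exact mul_le_of_le_one_right (Finset.prod_nonneg fun j _ => (hq0 _ _).le) (hq1 _)

/-- The code length of a name is a Birkhoff sum of a function of `(m + 1)`-letter names, so
empirical measures control it. -/
theorem wordWeight_itinerary (T : X → X) {k m : ℕ} (P : X → Fin k)
    {q : (Fin m → Fin k) → Fin k → ℝ} (hq0 : ∀ b c, 0 < q b c) (n : ℕ) (x : X) :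
    wordWeight q n (itinerary T P (m + n) x) = Real.exp (-∑ j ∈ Finset.range n,
      -Real.log (q (itinerary T P m (T^[j] x)) (P (T^[m] (T^[j] x))))) := by
  rw [← Finset.sum_neg_distrib, Real.exp_sum, ← Fin.prod_univ_eq_prod_range
    (fun j => Real.exp (- -Real.log (q (itinerary T P m (T^[j] x)) (P (T^[m] (T^[j] x)))))) n]
  refine Finset.prod_congr rfl fun j _ => ?_
  rw [neg_neg, Real.exp_log (hq0 _ _)]
  congr 1
  · funext i
    simp only [itinerary, ← Function.iterate_add_apply]
    rw [add_comm]
  · simp only [itinerary, ← Function.iterate_add_apply]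

end Words

/-! ### Bowen covers -/

section Covers

/-- A family of balls is a set of pairs, so indices with the same image are counted once and
identification only lowers the weight. -/
theorem coverWeight_image_le {X : Type*} (s : ℝ≥0) {ι : Type*} (S : Set ι) (f : ι → ℕ × X) (w : ι → ℝ≥0∞)
    (h : ∀ i ∈ S, ENNReal.ofReal (Real.exp (-((s : ℝ) * ((f i).1 : ℝ)))) ≤ w i) :
    coverWeight s (f '' S) ≤ ∑' i, w i :=
  calc
    coverWeight s (f '' S) ≤
        ∑' i : S, ENNReal.ofReal (Real.exp (-((s : ℝ) * ((f i).1 : ℝ)))) :=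
      ENNReal.tsum_le_tsum_comp_of_surjective (Set.imageFactorization_surjective (f := f) (s := S))
        (fun p : f '' S => ENNReal.ofReal (Real.exp (-((s : ℝ) * (p.1.1 : ℝ)))))
    _ ≤ ∑' i : S, w i := ENNReal.tsum_le_tsum fun i => h i i.2
    _ ≤ ∑' i, w i := ENNReal.tsum_comp_le_tsum_of_injective Subtype.val_injective w

variable {X : Type*} [MetricSpace X]

theorem bowenMeasure_mono (T : X → X) (s : ℝ≥0) (ε : ℝ) {Z Z' : Set X} (h : Z ⊆ Z') :
    bowenMeasure T s Z ε ≤ bowenMeasure T s Z' ε :=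
  iSup_mono fun _ => le_iInf₂ fun R hR =>
    iInf₂_le R ⟨hR.countable, hR.pos, hR.le, h.trans hR.cover⟩

theorem topEntropy_mono (T : X → X) {Z Z' : Set X} (h : Z ⊆ Z') :
    topEntropy T Z ≤ topEntropy T Z' :=
  iSup₂_mono fun ε _ => le_iInf₂ fun s hs =>
    iInf_le_of_le s (iInf_le _ (le_antisymm ((bowenMeasure_mono T s ε h).trans hs.le) zero_le))

theorem bowenPremeasure_union_le (T : X → X) (s : ℝ≥0) (ε : ℝ) (N : ℕ) (Z Z' : Set X) :
    bowenPremeasure T s (Z ∪ Z') ε N ≤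
      bowenPremeasure T s Z ε N + bowenPremeasure T s Z' ε N := by
  unfold bowenPremeasure
  simp_rw [ENNReal.iInf_add, ENNReal.add_iInf]
  refine le_iInf₂ fun R hR => le_iInf₂ fun R' hR' => ?_
  refine (iInf₂_le (R ∪ R') ⟨hR.countable.union hR'.countable, ?_, ?_, ?_⟩).trans
    (ENNReal.tsum_union_le (fun p : ℕ × X => ENNReal.ofReal (Real.exp (-((s : ℝ) * (p.1 : ℝ)))))
      R R')
  · rintro p (hp | hp)
    exacts [hR.pos p hp, hR'.pos p hp]
  · rintro p (hp | hp)
    exacts [hR.le p hp, hR'.le p hp]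
  · rw [Set.biUnion_union]
    exact Set.union_subset_union hR.cover hR'.cover

theorem bowenMeasure_union_eq_zero (T : X → X) (s : ℝ≥0) (ε : ℝ) {Z Z' : Set X}
    (h : bowenMeasure T s Z ε = 0) (h' : bowenMeasure T s Z' ε = 0) :
    bowenMeasure T s (Z ∪ Z') ε = 0 := by
  simp only [bowenMeasure, ENNReal.iSup_eq_zero] at h h' ⊢
  intro N
  exact le_antisymm ((bowenPremeasure_union_le T s ε N Z Z').trans (by simp [h N, h' N])) zero_le

theorem bowenMeasure_empty (T : X → X) (s : ℝ≥0) (ε : ℝ) : bowenMeasure T s ∅ ε = 0 := by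
  simp only [bowenMeasure, ENNReal.iSup_eq_zero]
  refine fun N => le_antisymm ?_ zero_le
  refine (iInf₂_le ∅ ⟨Set.countable_empty, by simp, by simp, by simp⟩).trans ?_
  simp [coverWeight]

/-- The total weight for each `n` is at most `k ^ m`, so a geometric series dominates. -/
theorem tsum_wordWeight_ne_top {k m : ℕ} {q : (Fin m → Fin k) → Fin k → ℝ}
    (hq0 : ∀ b c, 0 < q b c) (hq1 : ∀ b, ∑ c, q b c ≤ 1) {r : ℝ} (hr : r < 0) :
    ∑' p : Σ n : ℕ, (Fin (m + n) → Fin k),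
      ENNReal.ofReal (Real.exp (r * p.1) * wordWeight q p.1 p.2) ≠ ⊤ := by
  rw [ENNReal.tsum_sigma (fun (n : ℕ) (a : Fin (m + n) → Fin k) =>
    ENNReal.ofReal (Real.exp (r * n) * wordWeight q n a))]
  have hw : ∀ n a, 0 ≤ wordWeight q n a := fun n a => Finset.prod_nonneg fun j _ => (hq0 _ _).le
  have h1 : ∀ n : ℕ, ∑' a : Fin (m + n) → Fin k,
      ENNReal.ofReal (Real.exp (r * n) * wordWeight q n a) ≤
        ENNReal.ofReal (Real.exp r ^ n * (k : ℝ) ^ m) := by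
    intro n
    rw [tsum_fintype, ← ENNReal.ofReal_sum_of_nonneg
      fun a _ => mul_nonneg (Real.exp_pos _).le (hw n a), ← Finset.mul_sum, mul_comm r,
      Real.exp_nat_mul]
    exact ENNReal.ofReal_le_ofReal
      (mul_le_mul_of_nonneg_left (sum_wordWeight_le hq0 hq1 n) (by positivity))
  refine ne_top_of_le_ne_top ?_ (ENNReal.tsum_le_tsum h1)
  have h2 : Summable fun n : ℕ => Real.exp r ^ n * (k : ℝ) ^ m :=
    (summable_geometric_of_lt_one (Real.exp_pos r).le (by simpa using hr)).mul_right _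
  exact h2.tsum_ofReal_ne_top

/-- Points whose names are infinitely often coded by `q` at rate at most `s` have finite
`s'`-dimensional Bowen measure, `s < s'`. -/
theorem bowenMeasure_frequently_ne_top (T : X → X) {k m : ℕ} {P : X → Fin k} {ε : ℝ}
    (hP : ∀ x y, P x = P y → dist x y < ε) {q : (Fin m → Fin k) → Fin k → ℝ}
    (hq0 : ∀ b c, 0 < q b c) (hq1 : ∀ b, ∑ c, q b c ≤ 1) {s : ℝ} {s' : ℝ≥0} (hs : s < s') :
    bowenMeasure T s' {x | ∃ᶠ n : ℕ in atTop, ∑ j ∈ Finset.range n,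
      -Real.log (q (itinerary T P m (T^[j] x)) (P (T^[m] (T^[j] x)))) ≤ s * n} ε ≠ ⊤ := by
  refine ne_top_of_le_ne_top (tsum_wordWeight_ne_top hq0 hq1 (sub_neg.2 hs)) ?_
  rcases isEmpty_or_nonempty X with hX | hX
  · rw [Set.eq_empty_of_isEmpty {x | _}, bowenMeasure_empty]
    exact zero_le
  refine iSup_le fun N => ?_
  -- On these words `exp (-s' n) ≤ exp ((s - s') n) * wordWeight`, so the cover's weight is bounded
  -- by the convergent series above, uniformly in `N`.
  set S : Set (Σ n : ℕ, (Fin (m + n) → Fin k)) :=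
    {p | max N 1 ≤ p.1 ∧ Real.exp (-(s * p.1)) ≤ wordWeight q p.1 p.2}
  -- Each word is represented by a point with that name. A word that no point realises gets an
  -- arbitrary point, which only adds a superfluous ball.
  set f : (Σ n : ℕ, (Fin (m + n) → Fin k)) → ℕ × X :=
    fun p => (p.1, Function.invFun (itinerary T P (m + p.1)) p.2)
  refine le_trans (iInf₂_le (f '' S) ⟨(Set.to_countable S).image f, ?_, ?_, ?_⟩)
    (coverWeight_image_le s' S f _ ?_)
  · rintro p ⟨-, hp⟩
    refine ENNReal.ofReal_le_ofReal ?_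
    refine le_trans (le_of_eq ?_) (mul_le_mul_of_nonneg_left hp (Real.exp_pos _).le)
    rw [← Real.exp_add]
    congr 1
    ring
  · rintro _ ⟨p, hp, rfl⟩
    exact (le_max_right N 1).trans hp.1
  · rintro _ ⟨p, hp, rfl⟩
    exact (le_max_left N 1).trans hp.1
  · intro x hx
    obtain ⟨n, hn, hxn⟩ := frequently_atTop.1 hx (max N 1)
    refine Set.mem_biUnion (Set.mem_image_of_mem f
      (show (⟨n, itinerary T P (m + n) x⟩ : Σ n : ℕ, (Fin (m + n) → Fin k)) ∈ S from ⟨hn, ?_⟩)) ?_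
    · rw [wordWeight_itinerary T P hq0]
      exact Real.exp_le_exp.2 (neg_le_neg hxn)
    · intro j (hj : j < n)
      have h := Function.invFun_eq (f := itinerary T P (m + n))
        ⟨x, rfl⟩ (b := itinerary T P (m + n) x)
      exact hP _ _ (congrFun h ⟨j, by omega⟩).symm

end Covers

/-! ### Partitions with null boundaries -/

section Partitions

variable {X : Type*}

theorem measure_frontier_iInter_eq_zero [TopologicalSpace X] [MeasurableSpace X] (μ : Measure X)
    {ι : Type*} [Fintype ι] {s : ι → Set X} (hs : ∀ i, μ (frontier (s i)) = 0) :
    μ (frontier (⋂ i, s i)) = 0 := by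
  have h : ∀ t : Finset ι, μ (frontier (⋂ i ∈ t, s i)) = 0 := by
    classical
    intro t
    induction t using Finset.induction_on with
    | empty => simp
    | insert i t _ ih =>
      rw [Finset.set_biInter_insert]
      exact null_frontier_inter (hs i) ih
  simpa using h Finset.univ

variable [MetricSpace X] [MeasurableSpace X] [BorelSpace X]

/-- Around each point some radius below `ε / 2` gives a ball with null frontier. Finitely many such
balls cover the space, and a point is labelled by the set of balls containing it. Atoms are then
intersections of balls and complements of balls. -/
theorem exists_partition_null_frontier [CompactSpace X] (μ : Measure X) [IsFiniteMeasure μ]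
    {ε : ℝ} (hε : 0 < ε) : ∃ (k : ℕ) (P : X → Fin k), Measurable P ∧
      (∀ x y, P x = P y → dist x y < ε) ∧ ∀ i, μ (frontier (P ⁻¹' {i})) = 0 := by
  have h : ∀ x : X, ∃ r ∈ Set.Ioo 0 (ε / 2), μ (frontier (Metric.thickening r {x})) = 0 :=
    fun x => exists_null_frontier_thickening μ {x} (half_pos hε)
  choose r hr hr0 using h
  simp only [Metric.thickening_singleton] at hr0
  obtain ⟨t, ht⟩ := isCompact_univ.elim_finite_subcover (fun x : X => Metric.ball x (r x))
    (fun x => Metric.isOpen_ball) fun x _ => Set.mem_iUnion.2 ⟨x, Metric.mem_ball_self (hr x).1⟩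
  classical
  set e := Fintype.equivFin (t → Prop)
  set Q : X → t → Prop := fun x c => x ∈ Metric.ball (c : X) (r c) with hQ
  have hpre : ∀ i, (e ∘ Q) ⁻¹' {i} = ⋂ c : t, {x | x ∈ Metric.ball (c : X) (r c) ↔ e.symm i c} := by
    intro i
    ext x
    simp only [Set.mem_preimage, Set.mem_singleton_iff, Function.comp_apply, Set.mem_iInter,
      Set.mem_ofPred_eq, ← Equiv.eq_symm_apply, funext_iff, hQ, eq_iff_iff]
  have hcase : ∀ (c : t) (p : Prop), {x | x ∈ Metric.ball (c : X) (r c) ↔ p} =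
      Metric.ball (c : X) (r c) ∨ {x | x ∈ Metric.ball (c : X) (r c) ↔ p} =
        (Metric.ball (c : X) (r c))ᶜ := by
    intro c p
    by_cases hp : p
    · left; ext x; simp [hp]
    · right; ext x; simp [hp]
  refine ⟨_, e ∘ Q, measurable_to_countable' fun i => ?_, fun x y hxy => ?_, fun i => ?_⟩
  · rw [hpre]
    refine MeasurableSet.iInter fun c => ?_
    rcases hcase c (e.symm i c) with h | h <;> rw [h]
    exacts [measurableSet_ball, measurableSet_ball.compl]
  · have hxy : Q x = Q y := e.injective hxy
    obtain ⟨c, hc, hx⟩ := Set.mem_iUnion₂.1 (ht (Set.mem_univ x))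
    have hy : y ∈ Metric.ball c (r c) := (congrFun hxy ⟨c, hc⟩).mp hx
    have := (hr c).2
    rw [Metric.mem_ball] at hx hy
    linarith [dist_triangle_right x y c]
  · rw [hpre]
    refine measure_frontier_iInter_eq_zero μ fun c => ?_
    rcases hcase c (e.symm i c) with h | h <;> rw [h]
    · exact hr0 c
    · rw [frontier_compl]; exact hr0 c

/-- By continuity the frontier of a preimage lies in the preimage of the frontier, which is null by
invariance. -/
theorem measure_frontier_itinerary_eq_zero {T : X → X} (hT : Continuous T) {μ : Measure X}
    (hμ : MeasurePreserving T μ μ) {k : ℕ} {P : X → Fin k}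
    (hP : ∀ i, μ (frontier (P ⁻¹' {i})) = 0) (n : ℕ) (a : Fin n → Fin k) :
    μ (frontier (itinerary T P n ⁻¹' {a})) = 0 := by
  have h : itinerary T P n ⁻¹' {a} = ⋂ i : Fin n, T^[i] ⁻¹' (P ⁻¹' {a i}) := by
    ext x
    simp [itinerary, funext_iff]
  rw [h]
  refine measure_frontier_iInter_eq_zero μ fun i => ?_
  refine measure_mono_null ((hT.iterate i).frontier_preimage_subset _) ?_
  rw [(hμ.iterate i).measure_preimage isClosed_frontier.measurableSet.nullMeasurableSet]
  exact hP _

end Partitions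

/-! ### Empirical measures and their cluster points -/

section Empirical

variable {X : Type*} [MetricSpace X] [MeasurableSpace X] [BorelSpace X]

theorem integral_empiricalMeasure (T : X → X) (x : X) (n : ℕ) (f : X → ℝ) :
    ∫ y, f y ∂(empiricalMeasure T x n : Measure X) =
      ((n + 1 : ℕ) : ℝ)⁻¹ * ∑ j ∈ Finset.range (n + 1), f (T^[j] x) := by
  change ∫ y, f y ∂(((n + 1 : ℕ) : ℝ≥0∞)⁻¹ •
    ∑ j ∈ Finset.range (n + 1), Measure.dirac (T^[j] x)) = _
  rw [integral_smul_measure, integral_finsetSum_measure fun j _ => integrable_dirac (by simp)]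
  simp only [integral_dirac, smul_eq_mul, ENNReal.toReal_inv, ENNReal.toReal_natCast]

theorem sum_empiricalMeasure_itinerary {T : X → X} (hT : Continuous T) {k : ℕ} {P : X → Fin k}
    (hP : Measurable P) (m : ℕ) (φ : (Fin m → Fin k) → ℝ) (x : X) (n : ℕ) :
    ∑ b, (empiricalMeasure T x n : Measure X).real (itinerary T P m ⁻¹' {b}) * φ b =
      ((n + 1 : ℕ) : ℝ)⁻¹ * ∑ j ∈ Finset.range (n + 1), φ (itinerary T P m (T^[j] x)) := by
  classical
  have h : ∀ b, (empiricalMeasure T x n : Measure X).real (itinerary T P m ⁻¹' {b}) =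
      ((n + 1 : ℕ) : ℝ)⁻¹ * ∑ j ∈ Finset.range (n + 1),
        if itinerary T P m (T^[j] x) = b then 1 else 0 := by
    intro b
    rw [← integral_indicator_one
      (measurable_itinerary hT.measurable hP m (measurableSet_singleton b)),
      integral_empiricalMeasure]
    simp only [Set.indicator_apply, Set.mem_preimage, Set.mem_singleton_iff, Pi.one_apply]
  simp_rw [h, mul_assoc, Finset.sum_mul]
  rw [← Finset.mul_sum, Finset.sum_comm]
  simp

/-- The portmanteau theorem, applied to cylinders with `μ`-null frontier; continuity is obtained
only at `μ` itself. -/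
theorem tendsto_sum_measureReal_itinerary {T : X → X} (hT : Continuous T) {μ : ProbabilityMeasure X}
    (hμ : μ ∈ invariantMeasures T) {k : ℕ} {P : X → Fin k}
    (hP : ∀ i, (μ : Measure X) (frontier (P ⁻¹' {i})) = 0) (m : ℕ) (φ : (Fin m → Fin k) → ℝ) :
    Tendsto (fun ν : ProbabilityMeasure X =>
      ∑ b, (ν : Measure X).real (itinerary T P m ⁻¹' {b}) * φ b) (𝓝 μ)
      (𝓝 (∑ b, (μ : Measure X).real (itinerary T P m ⁻¹' {b}) * φ b)) := by
  refine tendsto_finsetSum _ fun b _ => Tendsto.mul_const _ ?_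
  exact (ENNReal.tendsto_toReal (measure_ne_top _ _)).comp
    (ProbabilityMeasure.tendsto_measure_of_null_frontier_of_tendsto' tendsto_id
      (measure_frontier_itinerary_eq_zero hT hμ hP m b))

theorem continuous_integral_probabilityMeasure [CompactSpace X] {f : X → ℝ} (hf : Continuous f) :
    Continuous fun μ : ProbabilityMeasure X => ∫ x, f x ∂(μ : Measure X) :=
  ProbabilityMeasure.continuous_integral_continuousMap (⟨f, hf⟩ : C(X, ℝ))

theorem mem_invariantMeasures_iff [CompactSpace X] {T : X → X} (hT : Continuous T)
    (μ : ProbabilityMeasure X) : μ ∈ invariantMeasures T ↔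
      ∀ f : C(X, ℝ), ∫ x, f (T x) ∂(μ : Measure X) = ∫ x, f x ∂(μ : Measure X) := by
  have hmap : ∀ f : C(X, ℝ),
      ∫ x, f x ∂((μ : Measure X).map T) = ∫ x, f (T x) ∂(μ : Measure X) := fun f =>
    integral_map hT.aemeasurable f.continuous.aestronglyMeasurable
  constructor
  · intro h f
    rw [← hmap, MeasurePreserving.map_eq h]
  · intro h
    refine ⟨hT.measurable, ?_⟩
    have : IsProbabilityMeasure ((μ : Measure X).map T) :=
      Measure.isProbabilityMeasure_map hT.aemeasurable
    refine ext_of_forall_integral_eq_of_IsFiniteMeasure fun f => ?_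
    exact (hmap f.toContinuousMap).trans (h f.toContinuousMap)

theorem isClosed_invariantMeasures [CompactSpace X] {T : X → X} (hT : Continuous T) :
    IsClosed (invariantMeasures T) := by
  have h : invariantMeasures T = ⋂ f : C(X, ℝ), {μ : ProbabilityMeasure X |
      ∫ x, f (T x) ∂(μ : Measure X) = ∫ x, f x ∂(μ : Measure X)} := by
    ext μ
    rw [mem_invariantMeasures_iff hT, Set.mem_iInter]
    rfl
  rw [h]
  exact isClosed_iInter fun f => isClosed_eq
    (continuous_integral_probabilityMeasure (f.continuous.comp hT))
    (continuous_integral_probabilityMeasure f.continuous)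

/-- Krylov–Bogolyubov: the integrals of `f ∘ T` and `f` against the empirical measure differ by a
telescoping sum of size at most `2 * ‖f‖ / (n + 1)`. -/
theorem mem_invariantMeasures_of_mapClusterPt [CompactSpace X] {T : X → X} (hT : Continuous T)
    {x : X} {μ : ProbabilityMeasure X} (h : MapClusterPt μ atTop (empiricalMeasure T x)) :
    μ ∈ invariantMeasures T := by
  obtain ⟨U, hU, hμ⟩ := mapClusterPt_iff_ultrafilter.1 h
  refine (mem_invariantMeasures_iff hT μ).2 fun f => sub_eq_zero.1 ?_
  have h1 := (((continuous_integral_probabilityMeasure (f.continuous.comp hT)).sub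
    (continuous_integral_probabilityMeasure f.continuous)).tendsto μ).comp hμ
  refine tendsto_nhds_unique h1 (Tendsto.mono_left ?_ hU)
  have h2 : ∀ n, ∫ y, f (T y) ∂(empiricalMeasure T x n : Measure X) -
      ∫ y, f y ∂(empiricalMeasure T x n : Measure X) =
        ((n + 1 : ℕ) : ℝ)⁻¹ * (f (T^[n + 1] x) - f x) := by
    intro n
    rw [integral_empiricalMeasure T x n fun y => f (T y), integral_empiricalMeasure, ← mul_sub,
      ← Finset.sum_sub_distrib]
    congr 1
    simp only [← Function.iterate_succ_apply']
    exact Finset.sum_range_sub (fun j => f (T^[j] x)) (n + 1)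
  refine Tendsto.congr (fun n => (h2 n).symm) ?_
  refine squeeze_zero_norm (a := fun n : ℕ => ((n + 1 : ℕ) : ℝ)⁻¹ * (2 * ‖f‖)) (fun n => ?_) ?_
  · rw [norm_mul, norm_inv, Real.norm_natCast]
    gcongr
    exact (norm_sub_le _ _).trans
      (by linarith [f.norm_coe_le_norm (T^[n + 1] x), f.norm_coe_le_norm x])
  · simpa using (((tendsto_add_atTop_iff_nat 1).2
      (tendsto_inv_atTop_nhds_zero_nat (𝕜 := ℝ))).mul_const (2 * ‖f‖))

/-- Bowen's entropy bound: the points whose empirical measures accumulate at some measure of a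
compact set `M` of invariant measures of entropy at most `t` carry topological entropy at most
`t`. -/
theorem topEntropy_mapClusterPt_le [CompactSpace X] {T : X → X} (hT : Continuous T)
    {M : Set (ProbabilityMeasure X)} (hM : IsCompact M) (hinv : M ⊆ invariantMeasures T) {t : ℝ≥0∞}
    (ht : ∀ μ ∈ M, measureEntropy T (μ : Measure X) ≤ t) :
    topEntropy T {x | ∃ μ ∈ M, MapClusterPt μ atTop (empiricalMeasure T x)} ≤ t := by
  refine iSup₂_le fun ε hε => le_of_forall_gt_imp_ge_of_dense fun c hc => ?_
  -- The chain is `t < s < s' < r < c`: `s` bounds the code length, the gap to `s'` makes the series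
  -- converge, and the gap to `r` turns a finite Bowen measure into a null one.
  obtain ⟨r, htr, hrc⟩ := ENNReal.lt_iff_exists_nnreal_btwn.1 hc
  obtain ⟨s', hts', hs'r⟩ := ENNReal.lt_iff_exists_nnreal_btwn.1 htr
  obtain ⟨s, hts, hss'⟩ := ENNReal.lt_iff_exists_nnreal_btwn.1 hts'
  refine le_trans (iInf₂_le r ?_) hrc.le
  -- Vanishing of the `r`-dimensional measure passes to subsets and finite unions, so compactness
  -- reduces the claim to a neighbourhood of each `μ ∈ M`.
  refine hM.induction_on (p := fun S => bowenMeasure T r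
    {x | ∃ μ ∈ S, MapClusterPt μ atTop (empiricalMeasure T x)} ε = 0) ?_ ?_ ?_ ?_
  · simpa using bowenMeasure_empty T r ε
  · intro S S' h hS'
    refine le_antisymm ((bowenMeasure_mono T r ε ?_).trans hS'.le) zero_le
    rintro x ⟨μ, hμ, hx⟩
    exact ⟨μ, h hμ, hx⟩
  · intro S S' hS hS'
    refine le_antisymm ((bowenMeasure_mono T r ε ?_).trans
      (bowenMeasure_union_eq_zero T r ε hS hS').le) zero_le
    rintro x ⟨μ, hμ | hμ, hx⟩
    exacts [Or.inl ⟨μ, hμ, hx⟩, Or.inr ⟨μ, hμ, hx⟩]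
  intro μ hμ
  obtain ⟨k, P, hPm, hPε, hP0⟩ := exists_partition_null_frontier (μ : Measure X) hε
  have hent : partitionEntropy T (μ : Measure X) P < ENNReal.ofReal s := by
    rw [ENNReal.ofReal_coe_nnreal]
    refine lt_of_le_of_lt ?_ ((ht μ hμ).trans_lt hts)
    exact le_iSup_of_le k (le_iSup₂_of_le P hPm le_rfl)
  obtain ⟨m, q, hq0, hq1, hq⟩ := exists_kernel_crossEntropy_lt hT.measurable (μ : Measure X) hPm hent
  set φ : (Fin (m + 1) → Fin k) → ℝ := fun b =>
    -Real.log (q (Fin.init (α := fun _ => Fin k) b) (b (Fin.last m)))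
  have hW := (tendsto_sum_measureReal_itinerary hT (hinv hμ) hP0 (m + 1) φ).eventually
    (gt_mem_nhds hq)
  obtain ⟨W, hWsub, hWo, hμW⟩ := mem_nhds_iff.1 hW
  refine ⟨W, mem_nhdsWithin_of_mem_nhds (hWo.mem_nhds hμW), ?_⟩
  have hlt : (s : ℝ) < s' := by exact_mod_cast hss'
  have hs'r : s' < r := by exact_mod_cast hs'r
  refine bowenMeasure_eq_zero_of_lt T hs'r _ ε (ne_top_of_le_ne_top
    (bowenMeasure_frequently_ne_top T hPε hq0 hq1 hlt) (bowenMeasure_mono T s' ε ?_))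
  rintro x ⟨ν, hν, hx⟩
  have hfreq : ∃ᶠ n in atTop, empiricalMeasure T x n ∈ W := hx.frequently (hWo.mem_nhds hν)
  -- `empiricalMeasure T x n` averages `n + 1` orbit points, so it controls the Birkhoff sum of
  -- length `n + 1`.
  refine (tendsto_add_atTop_nat 1).frequently (hfreq.mono fun n hn => ?_)
  have h1 : ∑ b, (empiricalMeasure T x n : Measure X).real (itinerary T P (m + 1) ⁻¹' {b}) * φ b <
    s := hWsub hn
  rw [sum_empiricalMeasure_itinerary hT hPm, inv_mul_lt_iff₀ (by positivity), mul_comm] at h1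
  exact h1.le

end Empirical

/-! ### Birkhoff sets -/

section Birkhoff

theorem birkhoffAverage_weakDual_apply {X B : Type*} [NormedAddCommGroup B] [NormedSpace ℝ B]
    (T : X → X) (Φ : X → WeakDual ℝ B) (n : ℕ) (x : X) (w : B) :
    birkhoffAverage ℝ T Φ n x w = (n : ℝ)⁻¹ * ∑ j ∈ Finset.range n, Φ (T^[j] x) w := by
  let ev : WeakDual ℝ B →+ ℝ := ⟨⟨fun f => f w, rfl⟩, fun _ _ => rfl⟩
  change (n : ℝ)⁻¹ * ev (∑ j ∈ Finset.range n, Φ (T^[j] x)) = _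
  rw [map_sum]
  rfl

theorem continuous_weakDual_apply {X B : Type*} [TopologicalSpace X] [NormedAddCommGroup B]
    [NormedSpace ℝ B] {Φ : X → WeakDual ℝ B} (hΦ : Continuous Φ) (w : B) :
    Continuous fun x => Φ x w :=
  (WeakDual.eval_continuous w).comp hΦ

/-- A real-valued `limsup` bounds the sequence eventually only when the sequence is bounded above;
compactness of `X` supplies this. -/
theorem isBoundedUnder_birkhoffAverage {X B : Type*} [TopologicalSpace X] [CompactSpace X]
    [NormedAddCommGroup B] [NormedSpace ℝ B] (T : X → X) {Φ : X → WeakDual ℝ B} (hΦ : Continuous Φ)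
    (x : X) (w : B) :
    IsBoundedUnder (· ≤ ·) atTop fun n : ℕ => birkhoffAverage ℝ T Φ n x w := by
  obtain ⟨C, hC⟩ := (isCompact_range (continuous_weakDual_apply hΦ w)).bddAbove
  refine isBoundedUnder_of_eventually_le (a := C) ?_
  filter_upwards [eventually_gt_atTop 0] with n hn
  rw [birkhoffAverage_weakDual_apply, inv_mul_le_iff₀ (by exact_mod_cast hn)]
  refine (Finset.sum_le_card_nsmul _ _ C fun j _ => hC ⟨_, rfl⟩).trans ?_
  simp

variable {X : Type*} [MetricSpace X] [MeasurableSpace X] [BorelSpace X]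
  {B : Type*} [NormedAddCommGroup B] [NormedSpace ℝ B]

theorem integral_empiricalMeasure_weakDual (T : X → X) (Φ : X → WeakDual ℝ B) (n : ℕ) (x : X)
    (w : B) : ∫ y, Φ y w ∂(empiricalMeasure T x n : Measure X) =
      birkhoffAverage ℝ T Φ (n + 1) x w := by
  rw [integral_empiricalMeasure T x n fun y => Φ y w, birkhoffAverage_weakDual_apply]

variable [CompactSpace X]

theorem isClosed_birkhoffMeasures {T : X → X} (hT : Continuous T) {Φ : X → WeakDual ℝ B}
    (hΦ : Continuous Φ) (α : WeakDual ℝ B) (E : Set B) : IsClosed (birkhoffMeasures T Φ α E) := by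
  have h : birkhoffMeasures T Φ α E = invariantMeasures T ∩
      ⋂ w ∈ E, {μ : ProbabilityMeasure X | ∫ x, Φ x w ∂(μ : Measure X) ≤ α w} := by
    ext μ
    simp [birkhoffMeasures]
  rw [h]
  exact (isClosed_invariantMeasures hT).inter (isClosed_biInter fun w _ => isClosed_le
    (continuous_integral_probabilityMeasure (continuous_weakDual_apply hΦ w)) continuous_const)

/-- Along an ultrafilter realising the cluster point, the averages converge to the integral, which
cannot exceed their limsup. -/
theorem mem_birkhoffMeasures_of_mapClusterPt {T : X → X} (hT : Continuous T)
    {Φ : X → WeakDual ℝ B} (hΦ : Continuous Φ) {α : WeakDual ℝ B} {E : Set B} {x : X}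
    (hx : x ∈ birkhoffSet T Φ α E) {μ : ProbabilityMeasure X}
    (h : MapClusterPt μ atTop (empiricalMeasure T x)) : μ ∈ birkhoffMeasures T Φ α E := by
  refine ⟨mem_invariantMeasures_of_mapClusterPt hT h, fun w hw => ?_⟩
  obtain ⟨U, hU, hμ⟩ := mapClusterPt_iff_ultrafilter.1 h
  have h1 := ((continuous_integral_probabilityMeasure
    (continuous_weakDual_apply hΦ w)).tendsto μ).comp hμ
  refine le_of_forall_gt_imp_ge_of_dense fun c hc => ?_
  have h2 : ∀ᶠ n : ℕ in atTop, birkhoffAverage ℝ T Φ n x w < c :=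
    eventually_lt_of_limsup_lt ((hx w hw).trans_lt hc) (isBoundedUnder_birkhoffAverage T hΦ x w)
  refine le_of_tendsto h1 (hU ?_)
  filter_upwards [(tendsto_add_atTop_nat 1).eventually h2] with n hn
  simp only [Function.comp_apply, integral_empiricalMeasure_weakDual]
  exact hn.le

theorem tendsto_birkhoffAverage_of_mem_genericPoints (T : X → X) {Φ : X → WeakDual ℝ B}
    (hΦ : Continuous Φ) {μ : ProbabilityMeasure X} {x : X} (hx : x ∈ genericPoints T μ) (w : B) :
    Tendsto (fun n : ℕ => birkhoffAverage ℝ T Φ n x w) atTop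
      (𝓝 (∫ y, Φ y w ∂(μ : Measure X))) := by
  refine (tendsto_add_atTop_iff_nat 1).1 ?_
  simp only [← integral_empiricalMeasure_weakDual]
  exact ((continuous_integral_probabilityMeasure
    (continuous_weakDual_apply hΦ w)).tendsto μ).comp hx

theorem genericPoints_subset_birkhoffSet (T : X → X) {Φ : X → WeakDual ℝ B} (hΦ : Continuous Φ)
    {α : WeakDual ℝ B} {E : Set B} {μ : ProbabilityMeasure X}
    (hμ : μ ∈ birkhoffMeasures T Φ α E) : genericPoints T μ ⊆ birkhoffSet T Φ α E := by
  intro x hx w hw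
  rw [(tendsto_birkhoffAverage_of_mem_genericPoints T hΦ hx w).limsup_eq]
  exact hμ.2 w hw

theorem topEntropy_birkhoffSet_le {T : X → X} (hT : Continuous T) {Φ : X → WeakDual ℝ B}
    (hΦ : Continuous Φ) (α : WeakDual ℝ B) (E : Set B) :
    topEntropy T (birkhoffSet T Φ α E) ≤
      ⨆ μ ∈ birkhoffMeasures T Φ α E, measureEntropy T (μ : Measure X) := by
  refine le_trans (topEntropy_mono T fun x hx => ?_) (topEntropy_mapClusterPt_le hT
    (isClosed_birkhoffMeasures hT hΦ α E).isCompact (fun μ hμ => hμ.1)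
    fun μ hμ => le_iSup₂_of_le μ hμ le_rfl)
  obtain ⟨μ, hμ⟩ := exists_clusterPt_of_compactSpace (map (empiricalMeasure T x) atTop)
  exact ⟨μ, mem_birkhoffMeasures_of_mapClusterPt hT hΦ hx hμ, hμ⟩

/-- A sequence in a compact space with a single possible cluster point converges to it. -/
theorem birkhoffSet_eq_genericPoints {T : X → X} (hT : Continuous T) {Φ : X → WeakDual ℝ B}
    (hΦ : Continuous Φ) {α : WeakDual ℝ B} {E : Set B} {μ : ProbabilityMeasure X}
    (h : birkhoffMeasures T Φ α E = {μ}) : birkhoffSet T Φ α E = genericPoints T μ := by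
  refine Set.Subset.antisymm (fun x hx => ?_) (genericPoints_subset_birkhoffSet T hΦ (by simp [h]))
  refine le_nhds_of_unique_clusterPt fun ν hν => ?_
  have h1 := mem_birkhoffMeasures_of_mapClusterPt hT hΦ hx hν
  rwa [h] at h1

end Birkhoff

/-! ### A test space in a prescribed universe -/

section TestSpace

universe u v

/-- A point is determined by its distances to a dense sequence, so the space embeds in `ℕ → ℝ`. This
lets `C(X)` be modelled in whatever universe the Banach spaces are drawn from. -/
theorem small_of_compact_metricSpace (X : Type u) [MetricSpace X] [CompactSpace X] :
    Small.{v} X := by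
  rcases isEmpty_or_nonempty X with hX | hX
  · infer_instance
  have h : Function.Injective fun (x : X) (n : ℕ) => dist x (TopologicalSpace.denseSeq X n) := by
    intro x y hxy
    have h1 : Continuous fun z => dist x z := by fun_prop
    have h2 : Continuous fun z => dist y z := by fun_prop
    have h3 := congrFun (Continuous.ext_on (TopologicalSpace.denseRange_denseSeq X) h1 h2
      (by rintro _ ⟨n, rfl⟩; exact congrFun hxy n)) y
    simpa using h3
  have : Small.{v} (ℕ → ℝ) := small_lift.{0, v} (ℕ → ℝ)
  exact small_of_injective h

/-- In every universe there is a test space for which the Birkhoff conditions single out a given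
invariant measure. -/
theorem exists_birkhoffMeasures_eq_singleton {X : Type u} [MetricSpace X] [CompactSpace X]
    [MeasurableSpace X] [BorelSpace X] (T : X → X) {μ : ProbabilityMeasure X}
    (hμ : μ ∈ invariantMeasures T) :
    ∃ (B : Type v) (_ : NormedAddCommGroup B) (_ : NormedSpace ℝ B) (_ : CompleteSpace B)
      (Φ : X → WeakDual ℝ B) (α : WeakDual ℝ B), Continuous Φ ∧
        birkhoffMeasures T Φ α Set.univ = {μ} := by
  have := small_of_compact_metricSpace.{u, v} X
  set e := Shrink.homeomorph.{v} X
  have : CompactSpace (Shrink.{v} X) := e.compactSpace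
  -- Dirac masses, with `X` replaced by its copy in the target universe; `α` below is integration
  -- against `μ`.
  set Φ : X → WeakDual ℝ C(Shrink.{v} X, ℝ) :=
    fun x => StrongDual.toWeakDual (ContinuousMap.evalCLM ℝ (e x))
  have hΦ : Continuous Φ := WeakDual.continuous_of_continuous_eval fun w =>
    w.continuous.comp e.continuous
  have hint : ∀ (ν : ProbabilityMeasure X) (w : C(Shrink.{v} X, ℝ)),
      Integrable (fun x => w (e x)) (ν : Measure X) := fun ν w =>
    (w.continuous.comp e.continuous).integrable_of_hasCompactSupport
      (HasCompactSupport.of_compactSpace _)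
  set A : C(Shrink.{v} X, ℝ) →ₗ[ℝ] ℝ :=
    { toFun := fun w => ∫ x, w (e x) ∂(μ : Measure X)
      map_add' := fun w w' => integral_add (hint μ w) (hint μ w')
      map_smul' := fun c w => integral_const_mul c _ }
  set α : WeakDual ℝ C(Shrink.{v} X, ℝ) := StrongDual.toWeakDual
    (A.mkContinuous 1 fun w => by
      refine (norm_integral_le_of_norm_le_const
        (ae_of_all _ fun x => w.norm_coe_le_norm (e x))).trans ?_
      simp)
  have hαw : ∀ w, α w = ∫ x, Φ x w ∂(μ : Measure X) := fun w => rfl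
  have hneg : ∀ (ν : ProbabilityMeasure X) (w : C(Shrink.{v} X, ℝ)),
      ∫ x, Φ x (-w) ∂(ν : Measure X) = -∫ x, Φ x w ∂(ν : Measure X) := fun ν w =>
    integral_neg fun x => w (e x)
  have hmem : ∀ ν ∈ birkhoffMeasures T Φ α Set.univ, ν = μ := by
    rintro ν ⟨-, hν⟩
    refine Subtype.ext (ext_of_forall_integral_eq_of_IsFiniteMeasure (μ := (ν : Measure X))
      (ν := (μ : Measure X)) fun f => ?_)
    set w : C(Shrink.{v} X, ℝ) := f.toContinuousMap.comp ⟨e.symm, e.symm.continuous⟩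
    have hfw : ∀ x, Φ x w = f x := fun x => congrArg f (e.symm_apply_apply x)
    -- Testing both `w` and `-w` turns the inequalities into equality of integrals.
    have h1 := hν w trivial
    have h2 := hν (-w) trivial
    rw [hαw, hneg, hneg] at h2
    rw [hαw] at h1
    have h3 := le_antisymm h1 (neg_le_neg_iff.1 h2)
    simpa only [hfw] using h3
  have hμmem : μ ∈ birkhoffMeasures T Φ α Set.univ := ⟨hμ, fun w _ => (hαw w).ge⟩
  refine ⟨C(Shrink.{v} X, ℝ), inferInstance, inferInstance, inferInstance, Φ, α, hΦ,
    Set.eq_singleton_iff_unique_mem.2 ⟨hμmem, hmem⟩⟩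

end TestSpace

end SaturatedSystem

/-! ### Equivalence of saturation and the variational principle. -/

theorem mainTheorem5 {X : Type*} [MetricSpace X] [CompactSpace X] [MeasurableSpace X]
    [BorelSpace X] (T : X → X) (hT : Continuous T) :
    SaturatedSystem.IsSaturated T ↔
      ∀ (B : Type*) [NormedAddCommGroup B] [NormedSpace ℝ B] [CompleteSpace B]
        (Φ : X → WeakDual ℝ B), Continuous Φ →
        ∀ (α : WeakDual ℝ B) (E : Set B),
          (SaturatedSystem.birkhoffMeasures T Φ α E).Nonempty →
          SaturatedSystem.topEntropy T (SaturatedSystem.birkhoffSet T Φ α E) =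
            ⨆ μ ∈ SaturatedSystem.birkhoffMeasures T Φ α E,
              SaturatedSystem.measureEntropy T (μ : Measure X) := by
  constructor
  · intro hsat B _ _ _ Φ hΦ α E _
    refine le_antisymm (SaturatedSystem.topEntropy_birkhoffSet_le hT hΦ α E)
      (iSup₂_le fun μ hμ => ?_)
    rw [← hsat μ hμ.1]
    exact SaturatedSystem.topEntropy_mono T
      (SaturatedSystem.genericPoints_subset_birkhoffSet T hΦ hμ)
  · intro h μ hμ
    obtain ⟨B, _, _, _, Φ, α, hΦ, hM⟩ :=
      SaturatedSystem.exists_birkhoffMeasures_eq_singleton T hμ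
    have h1 := h B Φ hΦ α Set.univ (by simp [hM])
    rw [SaturatedSystem.birkhoffSet_eq_genericPoints hT hΦ hM, hM] at h1
    simpa using h1
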